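/- Let $\beta>0$ and let $L:\mathbb{R}_+\to\mathbb{R}$ be slowly varying at infinity, i.e. measurable, eventually positive, and such that $L(\lambda z)/L(z)\to 1$ as $z\to+\infty$ for every $\lambda>0$. Let $S_1,S_2,\ldots$ be i.i.d. random variables with values in $\{1,2,\ldots\}$ such that $\mathbb{P}(S_1>n)=n^{-\beta}L(n)$ for all integers $n\ge 1$. For real $k$ put $p_k=\mathbb{P}(S_1>e^k)$, $\beta(k)=\ln(p_k)-\ln(p_{k+1})$, $\widehat p^{(n)}_k=\frac1n\sum_{i=1}^n\mathbb{I}\{S_i>e^k\}$ and $$\widehat\beta_n(k)=\ln(\widehat p^{(n)}_k)-\ln(\widehat p^{(n)}_{k+1})\ \text{ if } \widehat p^{(n)}_{k+1}>0,\qquad \widehat\beta_n(k)=0\ \text{ otherwise.}$$ Let $(k_n)_{n\geq 1}$ be a (deterministic) real sequence such that, as $n\to+\infty$, $k_n\to+\infty$, $(\ln n)\exp(k_n\beta)/n=o(L(\exp(k_n)))$ and $k_n=o(n)$. Then, as $n\to+\infty$, the following convergences in distribution hold: (i) $\sqrt{n p_{k_n}}\left(\widehat\beta_n(k_n)-\beta(k_n)\right)\Rightarrow\mathcal{N}(0,e^\beta-1)$;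 (ii) $\dfrac{\sqrt{n\widehat p^{(n)}_{k_n}}\left(\widehat\beta_n(k_n)-\beta(k_n)\right)}{\sqrt{e^{\widehat\beta_n(k_n)}-1}}\Rightarrow\mathcal{N}(0,1)$, the ratio being read as $0$ on the event $\{\widehat\beta_n(k_n)=0\}$. -/

import Mathlib

open MeasureTheory ProbabilityTheory Filter Asymptotics
open scoped Topology

namespace DiscretePareto

/-- Slowly varying functions at `+∞`: measurable, eventually positive, and
`L (c z) / L z → 1` as `z → +∞` for every `c > 0`. Only the restriction of `L` to the
positive half-line matters. -/
structure SlowlyVarying (L : ℝ → ℝ) : Prop where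
  measurable : Measurable L
  eventually_pos : ∀ᶠ z in atTop, 0 < L z
  tendsto_ratio : ∀ c : ℝ, 0 < c → Tendsto (fun z : ℝ => L (c * z) / L z) atTop (𝓝 1)

/-- `μ` is the law of a discrete generalized Pareto variable `S` with values in `{1, 2, …}`:
`ℙ(S > n) = n ^ (-β) L(n)` for all integers `n ≥ 1`, with `β > 0` and `L` slowly varying. -/
structure IsGenPareto (μ : Measure ℕ) (β : ℝ) (L : ℝ → ℝ) : Prop where
  prob : IsProbabilityMeasure μ
  index_pos : 0 < β
  slowlyVarying : SlowlyVarying L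
  zero_null : μ {0} = 0
  tail_eq : ∀ n : ℕ, 1 ≤ n → μ.real {m : ℕ | n < m} = (n : ℝ) ^ (-β) * L n

/-- The tail probability `p_x = ℙ(S > e ^ x)` of a variable `S` with law `μ`. -/
noncomputable def tailProb (μ : Measure ℕ) (x : ℝ) : ℝ :=
  μ.real {m : ℕ | Real.exp x < (m : ℝ)}

/-- `β(x) = ln p_x - ln p_{x+1}`. -/
noncomputable def betaAt (μ : Measure ℕ) (x : ℝ) : ℝ :=
  Real.log (tailProb μ x) - Real.log (tailProb μ (x + 1))

variable {Ω : Type*}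

/-- The empirical tail probability `(1/n) #{i : S_i > e ^ x}` computed from the first `n`
variables of the sequence `S` (indexed from `0`). -/
noncomputable def empTail (S : ℕ → Ω → ℕ) (n : ℕ) (x : ℝ) (ω : Ω) : ℝ :=
  (1 / (n : ℝ)) *
    ∑ i ∈ Finset.range n, Set.indicator {m : ℕ | Real.exp x < (m : ℝ)} (fun _ => (1 : ℝ)) (S i ω)

open Classical in
/-- The estimator `ln p̂_x - ln p̂_{x+1}`, set to `0` when `p̂_{x+1} = 0`. -/
noncomputable def betaHat (S : ℕ → Ω → ℕ) (n : ℕ) (x : ℝ) (ω : Ω) : ℝ :=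
  if 0 < empTail S n (x + 1) ω then
    Real.log (empTail S n x ω) - Real.log (empTail S n (x + 1) ω)
  else 0

end DiscretePareto

/-!
Write `p = p_{k_n}`, `q = p_{k_n + 1}` and let `x`, `y` be the relative errors of the empirical tail
probabilities at the levels `k_n` and `k_n + 1` (`DiscretePareto.relErr`). Then
`β̂ - β = log (1 + x) - log (1 + y)`, so to first order `√(n p) (β̂ - β)` is `√(n p) (x - y)`.
This is a sum of `n` i.i.d. centered variables bounded by a multiple of `(n p) ^ (-1/2)`, and the
variance of the sum is `p / q - 1`. Both claims follow once `n p → ∞` and `p / q → e ^ β`.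

The two asymptotic facts come from slow variation. The tail is given by `L` at integers only,
whereas the levels `e ^ k_n` are real, so one needs `L(⌊z⌋) ~ L(z)`: this is the uniform convergence
theorem for measurable slowly varying functions (`tendsto_sub_of_tendsto_zero`), obtained by
averaging truncated increments over a shift. It gives `p_x ~ e ^ (-β x) L(e ^ x)`
(`IsGenPareto.tendsto_tailProb_div`), from which `p / q → e ^ β` and, by the rate condition on
`k_n`, `n p → ∞` are immediate.

The probabilistic part rests on a central limit theorem for triangular arrays of bounded variables
(`tendstoInDistribution_sum_of_bounded`), proved through characteristic functions and Lévy's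
continuity theorem, and on Chebyshev's inequality. The latter shows that off an event of vanishing
probability both relative errors are below `(n p) ^ (-1/3)`
(`tendsto_measureReal_largeErr`); there the remainder of the linearization is negligible, and the
studentizing factor is close to its limit `(e ^ β - 1) ^ (-1/2)` by continuity. Slutsky's theorem
concludes.
-/

/-! ### Slowly varying functions and the tail of a discrete generalized Pareto law -/

namespace DiscretePareto

theorem min_one_add_le {a b : ℝ} (ha : 0 ≤ a) (hb : 0 ≤ b) :
    min 1 (a + b) ≤ min 1 a + min 1 b := by
  rcases le_total 1 a with h | h
  · rw [min_eq_left h]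
    exact (min_le_left _ _).trans (le_add_of_nonneg_right (le_min zero_le_one hb))
  · rcases le_total 1 b with h' | h'
    · rw [min_eq_left h']
      exact (min_le_left _ _).trans (le_add_of_nonneg_left (le_min zero_le_one ha))
    · rw [min_eq_right h, min_eq_right h']
      exact min_le_right _ _

/-- Increments `h (u + s) - h u` that vanish pointwise in `s` vanish in the mean over bounded
intervals. Truncating at `1` supplies the dominating function. -/
theorem tendsto_integral_min_one_abs_sub {ι : Type*} {l : Filter ι} [l.IsCountablyGenerated]
    {h : ℝ → ℝ} (hm : Measurable h)
    (hh : ∀ s : ℝ, Tendsto (fun x => h (x + s) - h x) atTop (𝓝 0))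
    {u : ι → ℝ} (hu : Tendsto u l atTop) (a b : ℝ) :
    Tendsto (fun i => ∫ s in a..b, min 1 |h (u i + s) - h (u i)|) l (𝓝 0) := by
  have key := intervalIntegral.tendsto_integral_filter_of_dominated_convergence (μ := volume)
    (a := a) (b := b) (l := l) (F := fun i s => min 1 |h (u i + s) - h (u i)|)
    (f := fun _ => (0 : ℝ)) (fun _ => (1 : ℝ))
    (Eventually.of_forall fun i => by
      apply Measurable.aestronglyMeasurable
      have : Measurable fun s => h (u i + s) := hm.comp (by fun_prop)
      fun_prop)
    (Eventually.of_forall fun i => Eventually.of_forall fun s _ => by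
      rw [Real.norm_of_nonneg (by positivity)]; exact min_le_left _ _)
    (by simp)
    (Eventually.of_forall fun s _ => by
      have h1 : Tendsto (fun i => |h (u i + s) - h (u i)|) l (𝓝 |0|) :=
        ((hh s).comp hu).abs
      have h2 := (tendsto_const_nhds (x := (1 : ℝ))).min h1
      simpa using h2)
  simpa using key

/-- Uniform convergence theorem for slowly varying functions, in additive and sequential form:
vanishing of `h (x + s) - h x` for each fixed `s` extends to shifts `t i → 0` that vary with the
base point. For every `s` the truncated increment from `u` to `u + t` is at most the sum of those
from `u` to `u + t + s` and from `u + t` to `u + t + s`; averaging over `s ∈ [0, 1]` bounds it by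
two integrals that tend to `0`. Measurability of `h` is what makes the averaging possible. -/
theorem tendsto_sub_of_tendsto_zero {ι : Type*} {l : Filter ι} [l.IsCountablyGenerated]
    {h : ℝ → ℝ} (hm : Measurable h)
    (hh : ∀ s : ℝ, Tendsto (fun x => h (x + s) - h x) atTop (𝓝 0))
    {u t : ι → ℝ} (hu : Tendsto u l atTop) (ht : Tendsto t l (𝓝 0)) :
    Tendsto (fun i => h (u i + t i) - h (u i)) l (𝓝 0) := by
  have hut : Tendsto (fun i => u i + t i) l atTop := hu.atTop_add ht
  have hsum := (tendsto_integral_min_one_abs_sub hm hh hu (-1) 2).add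
    (tendsto_integral_min_one_abs_sub hm hh hut 0 1)
  rw [add_zero] at hsum
  have hint : ∀ x y a b : ℝ,
      IntervalIntegrable (fun s => min 1 |h (x + y + s) - h x|) volume a b := by
    intro x y a b
    rw [intervalIntegrable_iff]
    refine Measure.integrableOn_of_bounded (M := 1) (by simp) ?_ ?_
    · apply Measurable.aestronglyMeasurable
      have : Measurable fun s => h (x + y + s) := hm.comp (by fun_prop)
      fun_prop
    · refine Eventually.of_forall fun s => ?_
      rw [Real.norm_of_nonneg (by positivity)]; exact min_le_left _ _
  have hint' : ∀ x a b : ℝ,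
      IntervalIntegrable (fun s => min 1 |h (x + s) - h x|) volume a b := by
    intro x a b; simpa using hint x 0 a b
  have hbound : ∀ᶠ i in l, min 1 |h (u i + t i) - h (u i)| ≤
      (∫ s in (-1 : ℝ)..2, min 1 |h (u i + s) - h (u i)|) +
        ∫ s in (0 : ℝ)..1, min 1 |h (u i + t i + s) - h (u i + t i)| := by
    filter_upwards [ht.eventually (Icc_mem_nhds (show (-1 : ℝ) < 0 by norm_num)
      (show (0 : ℝ) < 1 by norm_num))] with i hi
    have h1 : min 1 |h (u i + t i) - h (u i)| ≤ ∫ s in (0 : ℝ)..1,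
        (min 1 |h (u i + t i + s) - h (u i)| +
          min 1 |h (u i + t i + s) - h (u i + t i)|) := by
      have : min 1 |h (u i + t i) - h (u i)| =
          ∫ s in (0 : ℝ)..1, min 1 |h (u i + t i) - h (u i)| := by simp
      rw [this]
      refine intervalIntegral.integral_mono_on (by norm_num) (by simp)
        ((hint _ _ _ _).add (hint' _ _ _)) fun s _ => ?_
      have htri : |h (u i + t i) - h (u i)| ≤
          |h (u i + t i + s) - h (u i)| + |h (u i + t i + s) - h (u i + t i)| := by
        have := abs_sub_le (h (u i + t i)) (h (u i + t i + s)) (h (u i))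
        rw [abs_sub_comm (h (u i + t i)) (h (u i + t i + s))] at this
        linarith
      exact (min_le_min_left 1 htri).trans (min_one_add_le (abs_nonneg _) (abs_nonneg _))
    rw [intervalIntegral.integral_add (hint _ _ _ _) (hint' _ _ _)] at h1
    have h2 : (∫ s in (0 : ℝ)..1, min 1 |h (u i + t i + s) - h (u i)|) =
        ∫ s in (t i)..(1 + t i), min 1 |h (u i + s) - h (u i)| := by
      have := intervalIntegral.integral_comp_add_right (a := 0) (b := 1)
        (fun s => min 1 |h (u i + s) - h (u i)|) (t i)
      rw [zero_add] at this
      rw [← this]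
      refine intervalIntegral.integral_congr fun s _ => ?_
      rw [add_assoc, add_comm (t i) s]
    have h3 : (∫ s in (t i)..(1 + t i), min 1 |h (u i + s) - h (u i)|) ≤
        ∫ s in (-1 : ℝ)..2, min 1 |h (u i + s) - h (u i)| :=
      intervalIntegral.integral_mono_interval hi.1 (by linarith) (by linarith [hi.2])
        (Eventually.of_forall fun s => by positivity) (hint' _ _ _)
    linarith
  have hmin : Tendsto (fun i => min 1 |h (u i + t i) - h (u i)|) l (𝓝 0) :=
    tendsto_of_tendsto_of_tendsto_of_le_of_le' tendsto_const_nhds hsum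
      (Eventually.of_forall fun i => by positivity) hbound
  -- A truncated quantity tending to `0` eventually agrees with the untruncated one.
  rw [tendsto_zero_iff_abs_tendsto_zero]
  refine hmin.congr' ?_
  filter_upwards [hmin.eventually_lt_const (show (0 : ℝ) < 1 by norm_num)] with i hi
  rcases min_lt_iff.1 hi with h1 | h1
  · exact absurd h1 (lt_irrefl _)
  · exact min_eq_right h1.le

theorem SlowlyVarying.tendsto_log_sub {L : ℝ → ℝ} (hL : SlowlyVarying L) (s : ℝ) :
    Tendsto (fun x => Real.log (L (Real.exp (x + s))) - Real.log (L (Real.exp x)))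
      atTop (𝓝 0) := by
  have h1 := ((hL.tendsto_ratio (Real.exp s) (Real.exp_pos s)).comp
    Real.tendsto_exp_atTop).log one_ne_zero
  rw [Real.log_one] at h1
  refine h1.congr' ?_
  have hpos := Real.tendsto_exp_atTop.eventually hL.eventually_pos
  have hpos' := (Real.tendsto_exp_atTop.comp
    (tendsto_atTop_add_const_right atTop s tendsto_id)).eventually hL.eventually_pos
  filter_upwards [hpos, hpos'] with x hx hx'
  simp only [Function.comp_apply, id] at hx' ⊢
  rw [← Real.exp_add, add_comm s x, Real.log_div hx'.ne' hx.ne']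

/-- A slowly varying function takes asymptotically equal values at asymptotically equal
arguments. -/
theorem SlowlyVarying.tendsto_div_of_tendsto_one {ι : Type*} {l : Filter ι}
    [l.IsCountablyGenerated] {L : ℝ → ℝ} (hL : SlowlyVarying L) {x y : ι → ℝ}
    (hx : Tendsto x l atTop) (hxy : Tendsto (fun i => y i / x i) l (𝓝 1)) :
    Tendsto (fun i => L (y i) / L (x i)) l (𝓝 1) := by
  have hy : Tendsto y l atTop := by
    refine (hx.atTop_mul_pos one_pos hxy).congr' ?_
    filter_upwards [hx.eventually_gt_atTop 0] with i hi
    field_simp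
  have hm : Measurable fun v => Real.log (L (Real.exp v)) :=
    Real.measurable_log.comp (hL.measurable.comp Real.measurable_exp)
  have hu : Tendsto (fun i => Real.log (x i)) l atTop := Real.tendsto_log_atTop.comp hx
  have ht : Tendsto (fun i => Real.log (y i / x i)) l (𝓝 0) := by
    simpa using hxy.log one_ne_zero
  have h := (tendsto_sub_of_tendsto_zero hm hL.tendsto_log_sub hu ht).rexp
  rw [Real.exp_zero] at h
  refine h.congr' ?_
  filter_upwards [hx.eventually_gt_atTop 0, hy.eventually_gt_atTop 0,
    hx.eventually hL.eventually_pos, hy.eventually hL.eventually_pos] with i h1 h2 h3 h4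
  rw [← Real.log_mul h1.ne' (div_pos h2 h1).ne', mul_div_cancel₀ _ h1.ne', Real.exp_log h2,
    Real.exp_log h1, ← Real.log_div h4.ne' h3.ne', Real.exp_log (div_pos h4 h3)]

variable {μ : Measure ℕ} {β : ℝ} {L : ℝ → ℝ}

theorem IsGenPareto.tailProb_eq (hμ : IsGenPareto μ β L) {x : ℝ} (hx : 0 ≤ x) :
    tailProb μ x = (⌊Real.exp x⌋₊ : ℝ) ^ (-β) * L ⌊Real.exp x⌋₊ := by
  rw [← hμ.tail_eq _ (Nat.le_floor (by simpa using hx)), tailProb]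
  congr 1
  ext m
  exact (Nat.floor_lt (Real.exp_pos x).le).symm

/-- `p_x ~ e ^ (-β x) L(e ^ x)` along real `x`. The tail identity holds at integers only, so this
compares `L ⌊e ^ x⌋` with `L (e ^ x)`. -/
theorem IsGenPareto.tendsto_tailProb_div (hμ : IsGenPareto μ β L) :
    Tendsto (fun x => tailProb μ x / (Real.exp (-β * x) * L (Real.exp x))) atTop (𝓝 1) := by
  have h1 : Tendsto (fun x => (⌊Real.exp x⌋₊ : ℝ) / Real.exp x) atTop (𝓝 1) :=
    (tendsto_nat_floor_div_atTop (R := ℝ)).comp Real.tendsto_exp_atTop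
  have h2 := hμ.slowlyVarying.tendsto_div_of_tendsto_one Real.tendsto_exp_atTop h1
  have h3 := (h1.rpow_const (p := -β) (Or.inl one_ne_zero)).mul h2
  rw [Real.one_rpow, one_mul] at h3
  refine h3.congr' ?_
  filter_upwards [eventually_ge_atTop 0] with x hx
  rw [hμ.tailProb_eq hx, Real.div_rpow (by positivity) (by positivity), ← Real.exp_mul,
    mul_comm x, div_mul_div_comm]

theorem IsGenPareto.eventually_tailProb_pos (hμ : IsGenPareto μ β L) :
    ∀ᶠ x in atTop, 0 < tailProb μ x := by
  filter_upwards [hμ.tendsto_tailProb_div.eventually_const_lt (show (0 : ℝ) < 1 by norm_num)]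
    with x hx
  refine lt_of_le_of_ne measureReal_nonneg fun h => ?_
  rw [← h, zero_div] at hx
  exact lt_irrefl _ hx

theorem IsGenPareto.tendsto_tailProb_ratio (hμ : IsGenPareto μ β L) :
    Tendsto (fun x => tailProb μ x / tailProb μ (x + 1)) atTop (𝓝 (Real.exp β)) := by
  have hs : Tendsto (fun x : ℝ => x + 1) atTop atTop :=
    tendsto_atTop_add_const_right atTop 1 tendsto_id
  have h1 := hμ.tendsto_tailProb_div
  have h2 := h1.comp hs
  have h3 := (hμ.slowlyVarying.tendsto_ratio (Real.exp 1) (Real.exp_pos 1)).comp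
    Real.tendsto_exp_atTop
  have h4 := ((h1.div h2 one_ne_zero).div h3 one_ne_zero).const_mul (Real.exp β)
  rw [div_one, div_one, mul_one] at h4
  have hpos := Real.tendsto_exp_atTop.eventually hμ.slowlyVarying.eventually_pos
  refine h4.congr' ?_
  filter_upwards [hpos, hs.eventually hpos, hs.eventually hμ.eventually_tailProb_pos]
    with x h5 h6 h7
  simp only [Function.comp_apply, Pi.div_apply]
  rw [← Real.exp_add, add_comm 1 x,
    show -β * (x + 1) = -β * x - β by ring, Real.exp_sub]
  have := Real.exp_pos β
  have := Real.exp_pos (-β * x)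
  field_simp

/-- The expected number `n p_{k_n}` of exceedances of the level `e ^ k_n` tends to infinity; it
even dominates `log n`. -/
theorem IsGenPareto.tendsto_mul_tailProb_atTop (hμ : IsGenPareto μ β L) {k : ℕ → ℝ}
    (hk_top : Tendsto k atTop atTop)
    (hk_rate : (fun n : ℕ => Real.log n * Real.exp (k n * β) / n)
      =o[atTop] (fun n : ℕ => L (Real.exp (k n)))) :
    Tendsto (fun n : ℕ => n * tailProb μ (k n)) atTop atTop := by
  have hlog : Tendsto (fun n : ℕ => Real.log n) atTop atTop :=
    Real.tendsto_log_atTop.comp tendsto_natCast_atTop_atTop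
  have hpos := (Real.tendsto_exp_atTop.comp hk_top).eventually hμ.slowlyVarying.eventually_pos
  have h1 : Tendsto (fun n : ℕ => n * (Real.exp (-β * k n) * L (Real.exp (k n))))
      atTop atTop := by
    refine tendsto_atTop_mono' _ ?_ hlog
    filter_upwards [hk_rate.bound one_pos, hpos, eventually_gt_atTop 0] with n hn h2 h3
    have h3' : (0 : ℝ) < n := by exact_mod_cast h3
    simp only [Function.comp_apply] at h2
    rw [one_mul, Real.norm_of_nonneg h2.le] at hn
    have h4 := (le_abs_self _).trans hn
    rw [div_le_iff₀ h3'] at h4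
    have h5 : Real.exp (k n * β) * Real.exp (-β * k n) = 1 := by
      rw [← Real.exp_add]; ring_nf; simp
    calc Real.log n = Real.log n * Real.exp (k n * β) * Real.exp (-β * k n) := by
          rw [mul_assoc, h5, mul_one]
      _ ≤ L (Real.exp (k n)) * n * Real.exp (-β * k n) := by gcongr
      _ = _ := by ring
  refine (h1.atTop_mul_pos one_pos (hμ.tendsto_tailProb_div.comp hk_top)).congr' ?_
  filter_upwards [hpos] with n hn
  simp only [Function.comp_apply] at hn ⊢
  have := Real.exp_pos (-β * k n)
  field_simp

end DiscretePareto

/-! ### Triangular arrays of bounded variables -/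

namespace DiscretePareto

variable {Ω 𝓧 : Type*} [MeasurableSpace Ω] [MeasurableSpace 𝓧] {P : Measure Ω}
  {μ : Measure 𝓧} {S : ℕ → Ω → 𝓧}

theorem norm_exp_mul_I_sub_le {x : ℝ} (hx : |x| ≤ 1) :
    ‖Complex.exp (x * Complex.I) - 1 - x * Complex.I + x ^ 2 / 2‖ ≤ |x| ^ 3 := by
  have hn : ‖(x : ℂ) * Complex.I‖ = |x| := by simp
  have h := Complex.exp_bound (x := x * Complex.I) (by rwa [hn]) (n := 3) (by norm_num)
  rw [hn] at h
  have h2 : Complex.exp (x * Complex.I) - ∑ m ∈ Finset.range 3, (x * Complex.I) ^ m / m.factorial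
      = Complex.exp (x * Complex.I) - 1 - x * Complex.I + x ^ 2 / 2 := by
    simp only [Finset.sum_range_succ, Finset.range_zero, Finset.sum_empty, Nat.factorial]
    push_cast
    linear_combination -(x ^ 2 / 2 : ℂ) * Complex.I_sq
  rw [h2] at h
  refine h.trans ?_
  have : (Nat.succ 3 : ℝ) * ((Nat.factorial 3 : ℕ) * (3 : ℕ) : ℝ)⁻¹ ≤ 1 := by
    norm_num [Nat.factorial]
  exact mul_le_of_le_one_right (by positivity) this

/-- Second-order expansion of the characteristic function of a bounded centered variable, with an
error proportional to its variance. -/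
theorem norm_charFun_map_sub_le [IsProbabilityMeasure μ] {f : 𝓧 → ℝ} (hf : Measurable f) {C t : ℝ}
    (hfC : ∀ x, |f x| ≤ C) (h0 : ∫ x, f x ∂μ = 0) (ht : |t| * C ≤ 1) :
    ‖charFun (μ.map f) t - 1 + (t ^ 2 / 2 * ∫ x, f x ^ 2 ∂μ : ℝ)‖ ≤
      |t| ^ 3 * C * ∫ x, f x ^ 2 ∂μ := by
  have hbdd : ∀ x, |t * f x| ≤ 1 := fun x => by
    rw [abs_mul]; exact (mul_le_mul_of_nonneg_left (hfC x) (abs_nonneg t)).trans ht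
  have hi1 : Integrable f μ := Integrable.of_bound (by fun_prop) C (ae_of_all _ hfC)
  have hi2 : Integrable (fun x => f x ^ 2) μ :=
    Integrable.of_bound (by fun_prop) (C ^ 2) (ae_of_all _ fun x => by
      rw [Real.norm_of_nonneg (sq_nonneg _), ← sq_abs]
      exact pow_le_pow_left₀ (abs_nonneg _) (hfC x) 2)
  have hie : Integrable (fun x => Complex.exp ((t * f x : ℝ) * Complex.I)) μ :=
    Integrable.of_bound (by fun_prop) 1 (ae_of_all _ fun x => by
      rw [Complex.norm_exp_ofReal_mul_I])
  have hc1 : Integrable (fun x => ((t * f x : ℝ) : ℂ) * Complex.I) μ :=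
    ((hi1.const_mul t).ofReal (𝕜 := ℂ)).mul_const _
  have hc2 : Integrable (fun x => ((t * f x : ℝ) : ℂ) ^ 2 / 2) μ := by
    have := (hi2.const_mul (t ^ 2 / 2)).ofReal (𝕜 := ℂ)
    refine this.congr (ae_of_all _ fun x => ?_)
    simp only [Complex.coe_algebraMap]
    push_cast; ring
  have hrep : charFun (μ.map f) t - 1 + (t ^ 2 / 2 * ∫ x, f x ^ 2 ∂μ : ℝ) =
      ∫ x, (Complex.exp ((t * f x : ℝ) * Complex.I) - 1 - (t * f x : ℝ) * Complex.I +
        ((t * f x : ℝ) : ℂ) ^ 2 / 2) ∂μ := by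
    have hs1 : Integrable (fun x => Complex.exp ((t * f x : ℝ) * Complex.I) - 1) μ :=
      hie.sub (integrable_const _)
    have hs2 : Integrable (fun x => Complex.exp ((t * f x : ℝ) * Complex.I) - 1 -
        (t * f x : ℝ) * Complex.I) μ := hs1.sub hc1
    rw [integral_add hs2 hc2, integral_sub hs1 hc1, integral_sub hie (integrable_const _),
      integral_mul_const, integral_complex_ofReal, integral_const_mul, h0, charFun_apply_real,
      integral_map hf.aemeasurable (by fun_prop)]
    have : ∫ x, ((t * f x : ℝ) : ℂ) ^ 2 / 2 ∂μ = ((t ^ 2 / 2 * ∫ x, f x ^ 2 ∂μ : ℝ) : ℂ) := by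
      rw [← integral_const_mul, ← integral_complex_ofReal]
      congr 1; ext x; push_cast; ring
    rw [this]
    simp
  rw [hrep, ← integral_const_mul]
  refine norm_integral_le_of_norm_le (hi2.const_mul _) (ae_of_all _ fun x => ?_)
  refine (norm_exp_mul_I_sub_le (hbdd x)).trans ?_
  rw [abs_mul, mul_pow, ← sq_abs (f x), pow_succ |f x| 2, mul_assoc]
  refine mul_le_mul_of_nonneg_left ?_ (by positivity)
  rw [mul_comm C]
  exact mul_le_mul_of_nonneg_left (hfC x) (by positivity)

theorem charFun_map_sum_comp (hlaw : ∀ i, HasLaw (S i) μ P) (hindep : iIndepFun S P)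
    {f : 𝓧 → ℝ} (hf : Measurable f) (n : ℕ) (t : ℝ) :
    charFun (P.map fun ω => ∑ i ∈ Finset.range n, f (S i ω)) t = charFun (μ.map f) t ^ n := by
  have hi : iIndepFun (fun i ω => f (S i ω)) P := hindep.comp (fun _ => f) fun _ => hf
  have hm : ∀ i, AEMeasurable (fun ω => f (S i ω)) P := fun i =>
    hf.comp_aemeasurable (hlaw i).aemeasurable
  rw [(hi.restrict _).charFun_map_fun_finsetSum_eq_prod fun _ _ => hm _]
  have : ∀ i, P.map (fun ω => f (S i ω)) = μ.map f := fun i => by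
    rw [← (hlaw i).map_eq, AEMeasurable.map_map_of_aemeasurable hf.aemeasurable
      (hlaw i).aemeasurable]
    rfl
  simp [this]

/-- Central limit theorem for a triangular array whose `n`-th row is `f n (S 0), …, f n (S (n - 1))`
with `S` i.i.d.: it suffices that the entries are centered, that they are bounded by constants
tending to `0`, and that the variances of the row sums converge. -/
theorem tendstoInDistribution_sum_of_bounded [IsProbabilityMeasure P]
    [IsProbabilityMeasure μ] (hlaw : ∀ i, HasLaw (S i) μ P)
    (hindep : iIndepFun S P) {f : ℕ → 𝓧 → ℝ} (hf : ∀ n, Measurable (f n)) {C : ℕ → ℝ}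
    (hC : Tendsto C atTop (𝓝 0)) (hfC : ∀ᶠ n in atTop, ∀ x, |f n x| ≤ C n)
    (h0 : ∀ᶠ n in atTop, ∫ x, f n x ∂μ = 0) {v : NNReal}
    (hv : Tendsto (fun n : ℕ => n * ∫ x, f n x ^ 2 ∂μ) atTop (𝓝 (v : ℝ))) :
    TendstoInDistribution (fun (n : ℕ) ω => ∑ i ∈ Finset.range n, f n (S i ω)) atTop
      (id : ℝ → ℝ) (fun _ => P) (gaussianReal 0 v) where
  forall_aemeasurable n := Finset.aemeasurable_fun_sum _ fun i _ =>
    (hf n).comp_aemeasurable (hlaw i).aemeasurable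
  aemeasurable_limit := aemeasurable_id
  tendsto := by
    refine ProbabilityMeasure.tendsto_iff_tendsto_charFun.2 fun t => ?_
    simp only [ProbabilityMeasure.coe_mk, Measure.map_id, charFun_map_sum_comp hlaw hindep (hf _),
      charFun_gaussianReal]
    have key : Tendsto (fun n : ℕ => (n : ℂ) * (charFun (μ.map (f n)) t - 1)) atTop
        (𝓝 (-(t ^ 2 / 2 * v : ℝ) : ℂ)) := by
      have hr : Tendsto (fun n : ℕ => (n : ℂ) * (charFun (μ.map (f n)) t - 1 +
          (t ^ 2 / 2 * ∫ x, f n x ^ 2 ∂μ : ℝ))) atTop (𝓝 0) := by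
        have hb : Tendsto (fun n : ℕ => |t| ^ 3 * C n * (n * ∫ x, f n x ^ 2 ∂μ)) atTop
            (𝓝 0) := by
          simpa using (hC.const_mul (|t| ^ 3)).mul hv
        refine squeeze_zero_norm' ?_ hb
        have hCt : ∀ᶠ n in atTop, |t| * C n < 1 :=
          (hC.const_mul |t|).eventually_lt_const (by simp)
        filter_upwards [hfC, h0, hCt] with n h1 h2 h3
        rw [norm_mul, Complex.norm_natCast]
        calc _ ≤ (n : ℝ) * (|t| ^ 3 * C n * ∫ x, f n x ^ 2 ∂μ) := by
              gcongr; exact norm_charFun_map_sub_le (hf n) h1 h2 h3.le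
          _ = _ := by ring
      have hv' := (hv.const_mul (t ^ 2 / 2)).ofReal
      have := hr.sub hv'
      rw [zero_sub] at this
      refine this.congr fun n => ?_
      push_cast
      ring
    have := Complex.tendsto_one_add_pow_exp_of_tendsto key
    convert! this using 2
    · simp
    · congr 1; push_cast; ring

/-- Chebyshev bound for the relative error of the empirical frequency of `A`. -/
theorem measureReal_le_abs_average_div_sub_one_le [IsProbabilityMeasure P]
    (hlaw : ∀ i, HasLaw (S i) μ P) (hindep : iIndepFun S P)
    {A : Set 𝓧} (hA : MeasurableSet A) {n : ℕ} (hn : 0 < n) (hpos : 0 < μ.real A)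
    {δ : ℝ} (hδ : 0 < δ) :
    P.real {ω | δ ≤ |(1 / (n : ℝ) * ∑ i ∈ Finset.range n,
      A.indicator (fun _ => (1 : ℝ)) (S i ω)) / μ.real A - 1|} ≤ 1 / (n * μ.real A * δ ^ 2) := by
  have hn' : (0 : ℝ) < n := by exact_mod_cast hn
  set a := μ.real A with ha
  have hmA : Measurable (A.indicator fun _ => (1 : ℝ)) := measurable_const.indicator hA
  have hI : iIndepFun (fun i ω => A.indicator (fun _ => (1 : ℝ)) (S i ω)) P :=
    hindep.comp (fun _ => A.indicator fun _ => (1 : ℝ)) fun _ => hmA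
  have hmem : ∀ i, MemLp (fun ω => A.indicator (fun _ => (1 : ℝ)) (S i ω)) 2 P := fun i =>
    MemLp.of_bound (hmA.comp_aemeasurable (hlaw i).aemeasurable).aestronglyMeasurable 1
      (ae_of_all _ fun ω => by by_cases h : S i ω ∈ A <;> simp [h])
  have hmean : ∀ i, ∫ ω, A.indicator (fun _ => (1 : ℝ)) (S i ω) ∂P = a := fun i => by
    have := (hlaw i).integral_comp (f := A.indicator fun _ => (1 : ℝ))
      hmA.aestronglyMeasurable
    rw [integral_indicator_const _ hA] at this
    simpa [Function.comp_def] using this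
  have hvar : ∀ i, Var[fun ω => A.indicator (fun _ => (1 : ℝ)) (S i ω); P] ≤ a := fun i => by
    refine (variance_le_expectation_sq (hmem i).aestronglyMeasurable).trans_eq ?_
    rw [← hmean i]
    congr 1
    ext ω
    by_cases h : S i ω ∈ A <;> simp [h]
  have hvsum : Var[∑ i ∈ Finset.range n, fun ω => A.indicator (fun _ => (1 : ℝ)) (S i ω); P]
      ≤ n * a := by
    rw [IndepFun.variance_sum (fun i _ => hmem i) fun i _ j _ hij => hI.indepFun hij]
    exact (Finset.sum_le_card_nsmul _ _ _ fun i _ => hvar i).trans_eq (by simp)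
  have hsum : MemLp (fun ω => (1 / (n : ℝ) * ∑ i ∈ Finset.range n,
      A.indicator (fun _ => (1 : ℝ)) (S i ω)) / a) 2 P := by
    simp_rw [mul_div_right_comm]
    exact (memLp_finsetSum _ fun i _ => hmem i).const_mul _
  have hone : ∫ ω, (1 / (n : ℝ) * ∑ i ∈ Finset.range n,
      A.indicator (fun _ => (1 : ℝ)) (S i ω)) / a ∂P = 1 := by
    rw [integral_div, integral_const_mul,
      integral_finsetSum _ fun i _ => (hmem i).integrable (by norm_num)]
    simp only [hmean, Finset.sum_const, Finset.card_range, nsmul_eq_mul]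
    field_simp
  have hv : Var[fun ω => (1 / (n : ℝ) * ∑ i ∈ Finset.range n,
      A.indicator (fun _ => (1 : ℝ)) (S i ω)) / a; P] ≤ 1 / (n * a) := by
    have : (fun ω => (1 / (n : ℝ) * ∑ i ∈ Finset.range n,
        A.indicator (fun _ => (1 : ℝ)) (S i ω)) / a) = fun ω => (1 / n / a) *
          (∑ i ∈ Finset.range n, fun ω => A.indicator (fun _ => (1 : ℝ)) (S i ω)) ω := by
      ext ω; rw [Finset.sum_apply]; ring
    rw [this, variance_const_mul]
    calc _ ≤ (1 / n / a) ^ 2 * (n * a) := by gcongr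
      _ = _ := by field_simp
  have := meas_ge_le_variance_div_sq hsum hδ
  rw [hone] at this
  have h2 := ENNReal.toReal_mono ENNReal.ofReal_ne_top this
  rw [ENNReal.toReal_ofReal (div_nonneg (variance_nonneg _ _) (sq_nonneg _))] at h2
  refine h2.trans ?_
  rw [← div_div]
  gcongr

/-- Uniform convergence off exceptional sets of vanishing probability gives convergence in
probability. -/
theorem tendstoInMeasure_of_forall_eventually_dist_lt [IsProbabilityMeasure P]
    {E : Type*} [PseudoMetricSpace E] {D : ℕ → Ω → E} {g : Ω → E} {B : ℕ → Set Ω}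
    (hB : Tendsto (fun n => P.real (B n)) atTop (𝓝 0))
    (hD : ∀ ε > 0, ∀ᶠ n in atTop, ∀ ω, ω ∉ B n → dist (D n ω) (g ω) < ε) :
    TendstoInMeasure P D atTop g := by
  rw [tendstoInMeasure_iff_measureReal_dist]
  intro ε hε
  refine tendsto_of_tendsto_of_tendsto_of_le_of_le' tendsto_const_nhds hB
    (Eventually.of_forall fun n => measureReal_nonneg) ?_
  filter_upwards [hD ε hε] with n hn
  refine measureReal_mono fun ω hω => ?_
  by_contra h
  exact absurd (hn ω h) (not_lt.2 hω)

end DiscretePareto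

/-! ### Linearization of the estimator -/

namespace DiscretePareto

theorem abs_log_one_add_sub_le {x : ℝ} (hx : |x| ≤ 1 / 2) :
    |Real.log (1 + x) - x| ≤ 2 * x ^ 2 := by
  obtain ⟨h1, h2⟩ := abs_le.1 hx
  have hpos : 0 < 1 + x := by linarith
  have hup := Real.log_le_sub_one_of_pos hpos
  have hlow := Real.one_sub_inv_le_log_of_pos hpos
  have h3 : x - 2 * x ^ 2 ≤ 1 - (1 + x)⁻¹ := by
    have : 1 - (1 + x)⁻¹ - (x - 2 * x ^ 2) = x ^ 2 * (1 + 2 * x) / (1 + x) := by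
      field_simp; ring
    have h4 : 0 ≤ x ^ 2 * (1 + 2 * x) / (1 + x) :=
      div_nonneg (mul_nonneg (sq_nonneg x) (by linarith)) hpos.le
    linarith
  rw [abs_le]
  constructor <;> nlinarith [sq_nonneg x]

variable {Ω : Type*}

/-- The relative error `p̂_x / p_x - 1` of the empirical tail probability; it is `-1` when
`p_x = 0`. -/
noncomputable def relErr (μ : Measure ℕ) (S : ℕ → Ω → ℕ) (n : ℕ) (x : ℝ) (ω : Ω) : ℝ :=
  empTail S n x ω / tailProb μ x - 1

theorem empTail_eq {μ : Measure ℕ} {S : ℕ → Ω → ℕ} {n : ℕ} {x : ℝ} {ω : Ω}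
    (hp : 0 < tailProb μ x) : empTail S n x ω = tailProb μ x * (1 + relErr μ S n x ω) := by
  rw [relErr]; field_simp; ring

theorem betaHat_eq {μ : Measure ℕ} {S : ℕ → Ω → ℕ} {n : ℕ} {x : ℝ} {ω : Ω}
    (hp : 0 < tailProb μ x) (hq : 0 < tailProb μ (x + 1))
    (h2 : -1 < relErr μ S n (x + 1) ω) : betaHat S n x ω =
      Real.log (tailProb μ x * (1 + relErr μ S n x ω)) -
        Real.log (tailProb μ (x + 1) * (1 + relErr μ S n (x + 1) ω)) := by
  have hpos : 0 < empTail S n (x + 1) ω := by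
    rw [empTail_eq hq]; exact mul_pos hq (by linarith)
  rw [betaHat, if_pos hpos, empTail_eq hp, empTail_eq hq]

theorem betaHat_sub_betaAt {μ : Measure ℕ} {S : ℕ → Ω → ℕ} {n : ℕ} {x : ℝ} {ω : Ω}
    (hp : 0 < tailProb μ x) (hq : 0 < tailProb μ (x + 1))
    (h1 : -1 < relErr μ S n x ω) (h2 : -1 < relErr μ S n (x + 1) ω) :
    betaHat S n x ω - betaAt μ x =
      Real.log (1 + relErr μ S n x ω) - Real.log (1 + relErr μ S n (x + 1) ω) := by
  rw [betaHat_eq hp hq h2, betaAt, Real.log_mul hp.ne' (by linarith),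
    Real.log_mul hq.ne' (by linarith)]
  ring

theorem exp_betaHat {μ : Measure ℕ} {S : ℕ → Ω → ℕ} {n : ℕ} {x : ℝ} {ω : Ω}
    (hp : 0 < tailProb μ x) (hq : 0 < tailProb μ (x + 1))
    (h1 : -1 < relErr μ S n x ω) (h2 : -1 < relErr μ S n (x + 1) ω) :
    Real.exp (betaHat S n x ω) = tailProb μ x / tailProb μ (x + 1) *
      ((1 + relErr μ S n x ω) / (1 + relErr μ S n (x + 1) ω)) := by
  have h3 : 0 < 1 + relErr μ S n x ω := by linarith
  have h4 : 0 < 1 + relErr μ S n (x + 1) ω := by linarith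
  rw [betaHat_eq hp hq h2, Real.exp_sub, Real.exp_log (by positivity),
    Real.exp_log (by positivity), mul_div_mul_comm]

/-- Convergence in distribution depends on the limit only through its law. -/
theorem _root_.MeasureTheory.TendstoInDistribution.of_map_eq {ι E Ω' Ω'' : Type*} {Ω : ι → Type*}
    {m : ∀ i, MeasurableSpace (Ω i)} {μ : ∀ i, Measure (Ω i)} [∀ i, IsProbabilityMeasure (μ i)]
    [MeasurableSpace Ω'] {μ' : Measure Ω'} [IsProbabilityMeasure μ']
    [MeasurableSpace Ω''] {μ'' : Measure Ω''} [IsProbabilityMeasure μ'']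
    [TopologicalSpace E] [MeasurableSpace E] [OpensMeasurableSpace E]
    {X : ∀ i, Ω i → E} {Z : Ω' → E} {W : Ω'' → E} {l : Filter ι}
    (h : TendstoInDistribution X l Z μ μ') (hW : AEMeasurable W μ'')
    (hZW : μ'.map Z = μ''.map W) : TendstoInDistribution X l W μ μ'' where
  forall_aemeasurable := h.forall_aemeasurable
  aemeasurable_limit := hW
  tendsto := by
    convert! h.tendsto using 2
    exact congrArg 𝓝 (Subtype.ext hZW.symm)

variable [MeasurableSpace Ω] {P : Measure Ω} {μ : Measure ℕ} {S : ℕ → Ω → ℕ}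
  {k : ℕ → ℝ} {R : ℝ}

theorem aemeasurable_empTail (hlaw : ∀ i, HasLaw (S i) μ P) (n : ℕ) (x : ℝ) :
    AEMeasurable (empTail S n x) P :=
  (Finset.aemeasurable_fun_sum _ fun i _ =>
    (Measurable.of_discrete (f := {m : ℕ | Real.exp x < (m : ℝ)}.indicator
      fun _ => (1 : ℝ))).comp_aemeasurable (hlaw i).aemeasurable).const_mul _

theorem aemeasurable_betaHat (hlaw : ∀ i, HasLaw (S i) μ P) (n : ℕ) (x : ℝ) :
    AEMeasurable (betaHat S n x) P := by
  have h1 := aemeasurable_empTail hlaw n x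
  have h2 := aemeasurable_empTail hlaw n (x + 1)
  have hg : Measurable fun z : ℝ × ℝ => if 0 < z.2 then Real.log z.1 - Real.log z.2 else 0 :=
    Measurable.ite (measurableSet_lt measurable_const measurable_snd) (by fun_prop) (by fun_prop)
  refine (hg.comp_aemeasurable (h1.prodMk h2)).congr (ae_of_all _ fun ω => ?_)
  simp only [Function.comp_apply, betaHat]

/-- Asymptotic normality of the linear part of the estimator. The difference of relative errors is
a sum of the centered variables `1{S > e ^ k} / p_k - 1{S > e ^ (k + 1)} / p_{k + 1}`, of variance
`1 / p_{k + 1} - 1 / p_k` because the second event is contained in the first. -/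
theorem tendstoInDistribution_relErr_sub [IsProbabilityMeasure P] [IsProbabilityMeasure μ]
    (hlaw : ∀ i, HasLaw (S i) μ P) (hindep : iIndepFun S P)
    (hp : ∀ᶠ n in atTop, 0 < tailProb μ (k n)) (hq : ∀ᶠ n in atTop, 0 < tailProb μ (k n + 1))
    (hN : Tendsto (fun n : ℕ => n * tailProb μ (k n)) atTop atTop)
    (hr : Tendsto (fun n => tailProb μ (k n) / tailProb μ (k n + 1)) atTop (𝓝 R)) (hR : 1 ≤ R) :
    TendstoInDistribution (fun (n : ℕ) ω => Real.sqrt (n * tailProb μ (k n)) *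
        (relErr μ S n (k n) ω - relErr μ S n (k n + 1) ω))
      atTop (id : ℝ → ℝ) (fun _ => P) (gaussianReal 0 (R - 1).toNNReal) := by
  set A : ℝ → Set ℕ := fun x => {m : ℕ | Real.exp x < (m : ℝ)} with hA
  set f : ℕ → ℕ → ℝ := fun n m => Real.sqrt (n * tailProb μ (k n)) / n *
    ((A (k n)).indicator (fun _ => (1 : ℝ)) m / tailProb μ (k n) -
      (A (k n + 1)).indicator (fun _ => (1 : ℝ)) m / tailProb μ (k n + 1)) with hf
  have hind : ∀ x m, |(A x).indicator (fun _ => (1 : ℝ)) m| ≤ 1 := fun x m => by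
    by_cases h : m ∈ A x <;> simp [h]
  have hint : ∀ x, Integrable ((A x).indicator fun _ => (1 : ℝ)) μ := fun x =>
    (integrable_const _).indicator .of_discrete
  have hintegral : ∀ x, ∫ m, (A x).indicator (fun _ => (1 : ℝ)) m ∂μ = tailProb μ x := fun x => by
    rw [integral_indicator_const _ .of_discrete]; simp [tailProb, hA]
  have hsub : ∀ x, A (x + 1) ⊆ A x := fun x m hm =>
    (Real.exp_lt_exp.2 (lt_add_one x)).trans hm
  have hsum : ∀ (n : ℕ) ω, Real.sqrt (n * tailProb μ (k n)) *
      (relErr μ S n (k n) ω - relErr μ S n (k n + 1) ω) =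
      ∑ i ∈ Finset.range n, f n (S i ω) := by
    intro n ω
    simp only [hf, relErr, empTail]
    rw [← Finset.mul_sum, Finset.sum_sub_distrib, ← Finset.sum_div, ← Finset.sum_div]
    ring
  simp_rw [hsum]
  refine tendstoInDistribution_sum_of_bounded hlaw hindep (fun n => .of_discrete)
    (C := fun n => Real.sqrt (n * tailProb μ (k n)) / n *
      (1 / tailProb μ (k n) + 1 / tailProb μ (k n + 1))) ?_ ?_ ?_ ?_
  · have h1 : Tendsto (fun n : ℕ => (Real.sqrt (n * tailProb μ (k n)))⁻¹ *
        (1 + tailProb μ (k n) / tailProb μ (k n + 1))) atTop (𝓝 (0 * (1 + R))) :=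
      (tendsto_inv_atTop_zero.comp (Real.tendsto_sqrt_atTop.comp hN)).mul (hr.const_add 1)
    rw [zero_mul] at h1
    refine h1.congr' ?_
    filter_upwards [hp, hq, eventually_gt_atTop 0] with n h2 h3 h4
    have h4' : (0 : ℝ) < n := by exact_mod_cast h4
    have h5 : 0 < Real.sqrt (n * tailProb μ (k n)) := Real.sqrt_pos.2 (by positivity)
    have h6 := Real.sq_sqrt (show 0 ≤ n * tailProb μ (k n) by positivity)
    field_simp
    rw [h6]
  · refine Eventually.of_forall fun n m => ?_
    have h2 : 0 ≤ tailProb μ (k n) := measureReal_nonneg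
    have h3 : 0 ≤ tailProb μ (k n + 1) := measureReal_nonneg
    rw [hf, abs_mul, abs_of_nonneg (show 0 ≤ Real.sqrt (n * tailProb μ (k n)) / n by positivity)]
    refine mul_le_mul_of_nonneg_left ((abs_sub _ _).trans (add_le_add ?_ ?_)) (by positivity)
    · rw [abs_div, abs_of_nonneg h2]; gcongr; exact hind _ _
    · rw [abs_div, abs_of_nonneg h3]; gcongr; exact hind _ _
  · filter_upwards [hp, hq] with n h2 h3
    rw [hf, integral_const_mul, integral_sub ((hint _).div_const _) ((hint _).div_const _),
      integral_div, integral_div, hintegral, hintegral, div_self h2.ne', div_self h3.ne']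
    simp
  · rw [Real.coe_toNNReal _ (by linarith)]
    refine (hr.sub_const 1).congr' ?_
    filter_upwards [hp, hq, eventually_gt_atTop 0] with n h2 h3 h4
    have h4' : (0 : ℝ) < n := by exact_mod_cast h4
    have h6 := Real.sq_sqrt (show 0 ≤ n * tailProb μ (k n) by positivity)
    have hsq : ∀ m, f n m ^ 2 = tailProb μ (k n) / n *
        ((A (k n)).indicator (fun _ => (1 : ℝ)) m / tailProb μ (k n) ^ 2 +
          (A (k n + 1)).indicator (fun _ => (1 : ℝ)) m *
            (1 / tailProb μ (k n + 1) ^ 2 - 2 / (tailProb μ (k n) * tailProb μ (k n + 1)))) := by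
      intro m
      simp only [hf]
      rw [mul_pow, div_pow, h6]
      by_cases hm : m ∈ A (k n + 1)
      · rw [Set.indicator_of_mem hm, Set.indicator_of_mem (hsub _ hm)]
        field_simp; ring
      · rw [Set.indicator_of_notMem hm]
        by_cases hm' : m ∈ A (k n)
        · rw [Set.indicator_of_mem hm']; field_simp; ring
        · rw [Set.indicator_of_notMem hm']; simp
    simp_rw [hsq]
    rw [integral_const_mul, integral_add ((hint _).div_const _) ((hint _).mul_const _),
      integral_div, integral_mul_const, hintegral, hintegral]
    field_simp
    ring

end DiscretePareto

/-! ### Asymptotic normality -/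

namespace DiscretePareto

variable {Ω : Type*} [MeasurableSpace Ω] {P : Measure Ω} {μ : Measure ℕ} {S : ℕ → Ω → ℕ}
  {k : ℕ → ℝ} {R : ℝ}

theorem measureReal_le_abs_relErr_le [IsProbabilityMeasure P]
    (hlaw : ∀ i, HasLaw (S i) μ P) (hindep : iIndepFun S P) {n : ℕ} (hn : 0 < n) {x : ℝ}
    (hp : 0 < tailProb μ x) {δ : ℝ} (hδ : 0 < δ) :
    P.real {ω | δ ≤ |relErr μ S n x ω|} ≤ 1 / (n * tailProb μ x * δ ^ 2) :=
  measureReal_le_abs_average_div_sub_one_le hlaw hindep .of_discrete hn hp hδ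

/-- The threshold `(n p_{k_n}) ^ (-1/3)` for relative errors. Any exponent strictly between `-1/2`
and `-1/4` would do: relative errors are of order `(n p_{k_n}) ^ (-1/2)`, and the squared threshold
has to be negligible compared with `(n p_{k_n}) ^ (-1/2)`. -/
noncomputable def errRadius (μ : Measure ℕ) (k : ℕ → ℝ) (n : ℕ) : ℝ :=
  (n * tailProb μ (k n)) ^ (-(1 / 3 : ℝ))

/-- The event that the relative error at level `k_n` or at level `k_n + 1` reaches the threshold
`errRadius`. -/
def largeErr (μ : Measure ℕ) (S : ℕ → Ω → ℕ) (k : ℕ → ℝ) (n : ℕ) : Set Ω :=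
  {ω | errRadius μ k n ≤ |relErr μ S n (k n) ω|} ∪
    {ω | errRadius μ k n ≤ |relErr μ S n (k n + 1) ω|}

theorem tendsto_errRadius (hN : Tendsto (fun n : ℕ => n * tailProb μ (k n)) atTop atTop) :
    Tendsto (errRadius μ k) atTop (𝓝 0) :=
  (tendsto_rpow_neg_atTop (by norm_num)).comp hN

theorem tendsto_measureReal_largeErr [IsProbabilityMeasure P]
    (hlaw : ∀ i, HasLaw (S i) μ P) (hindep : iIndepFun S P)
    (hp : ∀ᶠ n in atTop, 0 < tailProb μ (k n)) (hq : ∀ᶠ n in atTop, 0 < tailProb μ (k n + 1))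
    (hN : Tendsto (fun n : ℕ => n * tailProb μ (k n)) atTop atTop)
    (hr : Tendsto (fun n => tailProb μ (k n) / tailProb μ (k n + 1)) atTop (𝓝 R)) :
    Tendsto (fun n => P.real (largeErr μ S k n)) atTop (𝓝 0) := by
  have h1 := ((hr.const_add 1).mul (tendsto_errRadius hN))
  rw [mul_zero] at h1
  refine tendsto_of_tendsto_of_tendsto_of_le_of_le' tendsto_const_nhds h1
    (Eventually.of_forall fun n => measureReal_nonneg) ?_
  filter_upwards [hp, hq, eventually_gt_atTop 0] with n h2 h3 h4
  have h4' : (0 : ℝ) < n := by exact_mod_cast h4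
  have hNn : 0 < n * tailProb μ (k n) := by positivity
  have hδ : 0 < errRadius μ k n := Real.rpow_pos_of_pos hNn _
  -- The exponent `-1/3` makes the Chebyshev bound `1 / (n p η ^ 2)` equal to the threshold `η`.
  have h5 : n * tailProb μ (k n) * errRadius μ k n ^ 3 = 1 := by
    rw [errRadius, ← Real.rpow_natCast, ← Real.rpow_mul hNn.le]
    norm_num
    rw [Real.rpow_neg_one]
    exact mul_inv_cancel₀ hNn.ne'
  refine (measureReal_union_le _ _).trans ((add_le_add
    (measureReal_le_abs_relErr_le hlaw hindep h4 h2 hδ)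
    (measureReal_le_abs_relErr_le hlaw hindep h4 h3 hδ)).trans_eq ?_)
  have h6 : 1 / (n * tailProb μ (k n) * errRadius μ k n ^ 2) = errRadius μ k n := by
    rw [div_eq_iff (by positivity)]
    linear_combination -h5
  have h7 : 1 / (n * tailProb μ (k n + 1) * errRadius μ k n ^ 2) =
      tailProb μ (k n) / tailProb μ (k n + 1) * errRadius μ k n := by
    rw [div_mul_eq_mul_div, div_eq_div_iff (by positivity) h3.ne']
    linear_combination -tailProb μ (k n + 1) * h5
  rw [h6, h7]
  ring

/-- Replacing the logarithms in the estimator by their linear parts is harmless in probability. -/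
theorem tendstoInMeasure_betaHat_sub_relErr [IsProbabilityMeasure P]
    (hlaw : ∀ i, HasLaw (S i) μ P) (hindep : iIndepFun S P)
    (hp : ∀ᶠ n in atTop, 0 < tailProb μ (k n)) (hq : ∀ᶠ n in atTop, 0 < tailProb μ (k n + 1))
    (hN : Tendsto (fun n : ℕ => n * tailProb μ (k n)) atTop atTop)
    (hr : Tendsto (fun n => tailProb μ (k n) / tailProb μ (k n + 1)) atTop (𝓝 R)) :
    TendstoInMeasure P ((fun (n : ℕ) ω => Real.sqrt (n * tailProb μ (k n)) *
        (betaHat S n (k n) ω - betaAt μ (k n))) -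
      fun (n : ℕ) ω => Real.sqrt (n * tailProb μ (k n)) *
        (relErr μ S n (k n) ω - relErr μ S n (k n + 1) ω)) atTop 0 := by
  refine tendstoInMeasure_of_forall_eventually_dist_lt
    (tendsto_measureReal_largeErr hlaw hindep hp hq hN hr) fun ε hε => ?_
  have hrad := tendsto_errRadius hN
  have hlim : Tendsto (fun n => 4 * (Real.sqrt (n * tailProb μ (k n)) * errRadius μ k n ^ 2))
      atTop (𝓝 (4 * 0)) := by
    have : Tendsto (fun n : ℕ => (n * tailProb μ (k n)) ^ (-(1 / 6 : ℝ))) atTop (𝓝 0) :=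
      (tendsto_rpow_neg_atTop (by norm_num)).comp hN
    refine (this.congr' ?_).const_mul 4
    filter_upwards [hN.eventually_gt_atTop 0] with n hn
    rw [errRadius, ← Real.rpow_natCast, ← Real.rpow_mul hn.le, Real.sqrt_eq_rpow,
      ← Real.rpow_add hn]
    norm_num
  rw [mul_zero] at hlim
  filter_upwards [hp, hq, hrad.eventually_lt_const (show (0 : ℝ) < 1 / 2 by norm_num),
    hlim.eventually_lt_const hε] with n h1 h2 h3 h4 ω hω
  simp only [largeErr, Set.mem_union, Set.mem_ofPred_eq, not_or, not_le] at hω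
  obtain ⟨hx, hy⟩ := hω
  have hx1 := abs_lt.1 (hx.trans h3)
  have hy1 := abs_lt.1 (hy.trans h3)
  simp only [Pi.sub_apply, Pi.zero_apply, Real.dist_eq, sub_zero]
  rw [betaHat_sub_betaAt h1 h2 (by linarith) (by linarith), ← mul_sub, abs_mul,
    abs_of_nonneg (Real.sqrt_nonneg _)]
  refine lt_of_le_of_lt ?_ h4
  rw [mul_left_comm]
  refine mul_le_mul_of_nonneg_left ?_ (Real.sqrt_nonneg _)
  have h5 := abs_log_one_add_sub_le (hx.trans h3).le
  have h6 := abs_log_one_add_sub_le (hy.trans h3).le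
  have h7 := sq_le_sq' (abs_lt.1 hx).1.le (abs_lt.1 hx).2.le
  have h8 := sq_le_sq' (abs_lt.1 hy).1.le (abs_lt.1 hy).2.le
  rw [abs_le] at h5 h6 ⊢
  constructor <;> linarith

/-- The factor that converts the normalization by the true tail probability into the normalization
by estimated quantities converges in probability: it is a continuous function of
`p_{k_n} / p_{k_n + 1}` and of the two relative errors. -/
theorem tendstoInMeasure_sqrt_div_sqrt [IsProbabilityMeasure P]
    (hlaw : ∀ i, HasLaw (S i) μ P) (hindep : iIndepFun S P)
    (hp : ∀ᶠ n in atTop, 0 < tailProb μ (k n)) (hq : ∀ᶠ n in atTop, 0 < tailProb μ (k n + 1))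
    (hN : Tendsto (fun n : ℕ => n * tailProb μ (k n)) atTop atTop)
    (hr : Tendsto (fun n => tailProb μ (k n) / tailProb μ (k n + 1)) atTop (𝓝 R)) (hR : 1 < R) :
    TendstoInMeasure P (fun (n : ℕ) ω => Real.sqrt (empTail S n (k n) ω / tailProb μ (k n)) /
        Real.sqrt (Real.exp (betaHat S n (k n) ω) - 1)) atTop
      fun _ => (Real.sqrt (R - 1))⁻¹ := by
  have hcont : ContinuousAt (fun z : ℝ × ℝ × ℝ => Real.sqrt (1 + z.2.1) /
      Real.sqrt (z.1 * ((1 + z.2.1) / (1 + z.2.2)) - 1)) (R, 0, 0) := by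
    refine ContinuousAt.div (by fun_prop) ?_ ?_
    · refine Real.continuous_sqrt.continuousAt.comp (ContinuousAt.sub (ContinuousAt.mul
        (by fun_prop) (ContinuousAt.div (by fun_prop) (by fun_prop) (by simp))) (by fun_prop))
    · simpa using (Real.sqrt_pos.2 (sub_pos.2 hR)).ne'
  refine tendstoInMeasure_of_forall_eventually_dist_lt
    (tendsto_measureReal_largeErr hlaw hindep hp hq hN hr) fun ε hε => ?_
  obtain ⟨δ, hδ, hball⟩ := Metric.continuousAt_iff.1 hcont ε hε
  filter_upwards [hp, hq,
    (tendsto_errRadius hN).eventually_lt_const (show (0 : ℝ) < min 1 δ by positivity),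
    Metric.tendsto_nhds.1 hr δ hδ] with n h1 h2 h3 h4 ω hω
  simp only [largeErr, Set.mem_union, Set.mem_ofPred_eq, not_or, not_le] at hω
  obtain ⟨hx, hy⟩ := hω
  obtain ⟨hx1, hx2⟩ := lt_min_iff.1 (hx.trans h3)
  obtain ⟨hy1, hy2⟩ := lt_min_iff.1 (hy.trans h3)
  have h5 := hball (x := (tailProb μ (k n) / tailProb μ (k n + 1), relErr μ S n (k n) ω,
    relErr μ S n (k n + 1) ω)) (by
      rw [Prod.dist_eq, Prod.dist_eq, Real.dist_eq (relErr _ _ _ _ _) 0,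
        Real.dist_eq (relErr _ _ _ _ _) 0, sub_zero, sub_zero]
      exact max_lt h4 (max_lt hx2 hy2))
  rw [exp_betaHat h1 h2 (abs_lt.1 hx1).1 (abs_lt.1 hy1).1, empTail_eq h1,
    mul_div_cancel_left₀ _ h1.ne']
  simpa using h5

/-- Asymptotic normality of the estimator for any law whose tail ratio `p_{k_n} / p_{k_n + 1}`
converges to some `R ≥ 1` while `n p_{k_n} → ∞`. -/
theorem tendstoInDistribution_betaHat [IsProbabilityMeasure P]
    (hlaw : ∀ i, HasLaw (S i) μ P) (hindep : iIndepFun S P)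
    (hp : ∀ᶠ n in atTop, 0 < tailProb μ (k n)) (hq : ∀ᶠ n in atTop, 0 < tailProb μ (k n + 1))
    (hN : Tendsto (fun n : ℕ => n * tailProb μ (k n)) atTop atTop)
    (hr : Tendsto (fun n => tailProb μ (k n) / tailProb μ (k n + 1)) atTop (𝓝 R)) (hR : 1 ≤ R) :
    TendstoInDistribution (fun (n : ℕ) ω => Real.sqrt (n * tailProb μ (k n)) *
        (betaHat S n (k n) ω - betaAt μ (k n)))
      atTop (id : ℝ → ℝ) (fun _ => P) (gaussianReal 0 (R - 1).toNNReal) := by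
  have : IsProbabilityMeasure μ := (hlaw 0).isProbabilityMeasure_iff.1 inferInstance
  exact tendstoInDistribution_of_tendstoInMeasure_sub _ _
    (tendstoInDistribution_relErr_sub hlaw hindep hp hq hN hr hR)
    (tendstoInMeasure_betaHat_sub_relErr hlaw hindep hp hq hN hr)
    fun n => ((aemeasurable_betaHat hlaw n _).sub_const _).const_mul _

/-- The studentized form of `tendstoInDistribution_betaHat`; here `R > 1` keeps the limiting
variance positive. -/
theorem tendstoInDistribution_studentized_betaHat [IsProbabilityMeasure P]
    (hlaw : ∀ i, HasLaw (S i) μ P) (hindep : iIndepFun S P)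
    (hp : ∀ᶠ n in atTop, 0 < tailProb μ (k n)) (hq : ∀ᶠ n in atTop, 0 < tailProb μ (k n + 1))
    (hN : Tendsto (fun n : ℕ => n * tailProb μ (k n)) atTop atTop)
    (hr : Tendsto (fun n => tailProb μ (k n) / tailProb μ (k n + 1)) atTop (𝓝 R)) (hR : 1 < R) :
    TendstoInDistribution (fun (n : ℕ) ω => Real.sqrt (n * empTail S n (k n) ω) *
        (betaHat S n (k n) ω - betaAt μ (k n)) / Real.sqrt (Real.exp (betaHat S n (k n) ω) - 1))
      atTop (id : ℝ → ℝ) (fun _ => P) (gaussianReal 0 1) := by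
  have hb := fun n => aemeasurable_betaHat hlaw n (k n)
  have he := fun n => aemeasurable_empTail hlaw n (k n)
  have hprod := (tendstoInDistribution_betaHat hlaw hindep hp hq hN hr hR.le
    ).continuous_comp_prodMk_of_tendstoInMeasure_const (g := fun z : ℝ × ℝ => z.1 * z.2)
    (by fun_prop) (tendstoInMeasure_sqrt_div_sqrt hlaw hindep hp hq hN hr hR)
    (fun n => ((he n).div_const _).sqrt.div ((hb n).exp.sub_const 1).sqrt)
  have hnormal := hprod.of_map_eq (W := (id : ℝ → ℝ)) (μ'' := gaussianReal 0 1)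
    aemeasurable_id (by
      simp only [id]
      rw [gaussianReal_map_mul_const, Measure.map_id, mul_zero]
      congr 1
      ext
      have h1 : 0 < R - 1 := sub_pos.2 hR
      simp only [NNReal.coe_mul, NNReal.coe_mk, NNReal.coe_one, Real.coe_toNNReal _ h1.le,
        inv_pow, Real.sq_sqrt h1.le]
      exact inv_mul_cancel₀ h1.ne')
  refine tendstoInDistribution_of_tendstoInMeasure_sub _ _ hnormal ?_ fun n =>
    ((((he n).const_mul _).sqrt.mul ((hb n).sub_const _)).div ((hb n).exp.sub_const 1).sqrt)
  -- The two normalizations agree as soon as `p_{k_n} ≠ 0`, hence for all large `n`.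
  refine tendstoInMeasure_of_forall_eventually_dist_lt (B := fun _ => ∅) (by simp) fun ε hε => ?_
  filter_upwards [hp] with n hn ω _
  have h1 : Real.sqrt (n * empTail S n (k n) ω) = Real.sqrt (n * tailProb μ (k n)) *
      Real.sqrt (empTail S n (k n) ω / tailProb μ (k n)) := by
    rw [← Real.sqrt_mul (by positivity)]
    congr 1
    field_simp
  simp only [Pi.sub_apply, Pi.zero_apply, h1]
  rw [show ∀ a b c d : ℝ, a * b * c / d - a * c * (b / d) = 0 by intros; ring, dist_self]
  exact hε

end DiscretePareto

theorem theorem2 {Ω : Type*} [MeasurableSpace Ω] (P : Measure Ω) [IsProbabilityMeasure P]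
    (μ : Measure ℕ) (β : ℝ) (L : ℝ → ℝ) (hμ : DiscretePareto.IsGenPareto μ β L)
    (S : ℕ → Ω → ℕ) (hlaw : ∀ i, HasLaw (S i) μ P) (hindep : iIndepFun S P)
    (k : ℕ → ℝ) (hk_top : Tendsto k atTop atTop)
    (hk_rate : (fun n : ℕ => Real.log n * Real.exp (k n * β) / n)
      =o[atTop] (fun n : ℕ => L (Real.exp (k n))))
    (hk_small : k =o[atTop] (fun n : ℕ => (n : ℝ))) :
    TendstoInDistribution
      (fun (n : ℕ) (ω : Ω) => Real.sqrt (n * DiscretePareto.tailProb μ (k n)) *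
        (DiscretePareto.betaHat S n (k n) ω - DiscretePareto.betaAt μ (k n)))
      atTop (id : ℝ → ℝ) (fun _ => P) (gaussianReal 0 (Real.toNNReal (Real.exp β - 1))) ∧
    TendstoInDistribution
      (fun (n : ℕ) (ω : Ω) => Real.sqrt (n * DiscretePareto.empTail S n (k n) ω) *
        (DiscretePareto.betaHat S n (k n) ω - DiscretePareto.betaAt μ (k n)) /
          Real.sqrt (Real.exp (DiscretePareto.betaHat S n (k n) ω) - 1))
      atTop (id : ℝ → ℝ) (fun _ => P) (gaussianReal 0 1) := by
  have hk1 : Tendsto (fun n => k n + 1) atTop atTop :=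
    tendsto_atTop_add_const_right atTop 1 hk_top
  have hp := hk_top.eventually hμ.eventually_tailProb_pos
  have hq := hk1.eventually hμ.eventually_tailProb_pos
  have hN := hμ.tendsto_mul_tailProb_atTop hk_top hk_rate
  have hr := hμ.tendsto_tailProb_ratio.comp hk_top
  have hR : 1 < Real.exp β := Real.one_lt_exp_iff.2 hμ.index_pos
  exact ⟨DiscretePareto.tendstoInDistribution_betaHat hlaw hindep hp hq hN hr hR.le,
    DiscretePareto.tendstoInDistribution_studentized_betaHat hlaw hindep hp hq hN hr hR⟩
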